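/- For an algebraic number $\alpha\neq 0$ let $m(\alpha)=[\mathbb Q(\alpha):\mathbb Q]\cdot h(\alpha)$ be its logarithmic Mahler measure, where $h$ is the absolute logarithmic Weil height. Let $\mathcal P(\alpha)$ be the set of product representations of $\alpha$, i.e. tuples $(\alpha_1,\dots,\alpha_N)$, $N\ge 1$, of nonzero algebraic numbers with $\alpha=\alpha_1\cdots\alpha_N$, and for $t>0$ put $$m_t(\alpha)=\inf\Big\{\Big(\sum_{n=1}^N m(\alpha_n)^t\Big)^{1/t} : (\alpha_1,\dots,\alpha_N)\in\mathcal P(\alpha)\Big\}.$$ A finite set $\mathcal X\subseteq\mathcal P(\alpha)$ is an infimum set for $\alpha$ if, for every $t>0$, $m_t(\alpha)$ is the minimum of $\big(\sum_{n=1}^N m(\alpha_n)^t\big)^{1/t}$ over $(\alpha_1,\dots,\alpha_N)\in\mathcal X$. A factorization of $\alpha$ is an element of $\mathcal P(\alpha)$ of the form $(r_1/s_1,\dots,r_N/s_N)$ with positive integers $r_n,s_n$ such that $r_n/s_n\ne 1$ for all $n$ and $\gcd(r_m,s_n)=1$ for all $m,n$. For a positive irrational number $\xi$ let $\mathcal U(\xi)$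 (resp. $\mathcal L(\xi)$) be the set of pairs $(a,b)\neq(0,0)$ of nonnegative integers with $a>b\xi$ (resp. $a<b\xi$). With the conventions $a/0=\infty$ and $\gcd(a,0)=a$ for $a>0$, a pair $(a,b)$ with $\gcd(a,b)=1$ is an upper best approximation for $\xi$ if $(a,b)\in\mathcal U(\xi)$ and $a/b=\min\{m/n:(m,n)\in\mathcal U(\xi),\ m\le a\}$; it is a lower best approximation for $\xi$ if $(a,b)\in\mathcal L(\xi)$ and $a/b=\max\{m/n:(m,n)\in\mathcal L(\xi),\ n\le b\}$. Let $p$ and $q$ be distinct primes, let $\xi=\log q/\log p$, suppose that $(a,b)$ is an upper or lower best approximation for $\xi$, and set $\alpha=p^a/q^b$. Let $\mathcal B(\alpha)$ be the set of all factorizations of $\alpha$ of the form $(p^{a_1}/q^{b_1},\dots,p^{a_N}/q^{b_N})$ in which every $(a_n,b_n)$ is an upper or lower best approximation for $\xi$. Then $\mathcal B(\alpha)$ is an infimum set for $\alpha$; that is, $\mathcal B(\alpha)$ is finite and, for every $t>0$, $m_t(\alpha)$ is the minimum of $\big(\sum_{n=1}^N m(\alpha_n)^t\big)^{1/t}$ over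 $(\alpha_1,\dots,\alpha_N)\in\mathcal B(\alpha)$. -/

import Mathlib

open scoped ENNReal IntermediateField

namespace MetricMahler

noncomputable section

/-! ### Mahler measure and `t`-metric Mahler measures -/

/-- The field of algebraic numbers. -/
abbrev Alg : Type := AlgebraicClosure ℚ

/-- The logarithmic Mahler measure `m(α) = [ℚ(α) : ℚ] · h(α)`, where `h` is the absolute
logarithmic Weil height. -/
def mahler (α : Alg) : ℝ :=
  (Module.finrank ℚ ℚ⟮α⟯ : ℝ) * NumberField.absLogHeight₁ α

/-- The set `𝒫(α)` of product representations of `α`: the tuples `(α₁, …, α_N)`, `N ≥ 1`, of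
nonzero algebraic numbers whose product is `α`. -/
def productReps (α : Alg) : Set (List Alg) :=
  {A | A ≠ [] ∧ (∀ x ∈ A, x ≠ 0) ∧ A.prod = α}

/-- The measure function `f_A(t) = (∑ₙ m(αₙ)^t)^(1/t)` of a tuple `A = (α₁, …, α_N)`. -/
def measureFun (A : List Alg) (t : ℝ) : ℝ :=
  (A.map fun x => mahler x ^ t).sum ^ (1 / t)

/-- The `t`-metric Mahler measure `m_t(α)`: the infimum of `f_A(t)` over all product
representations `A` of `α`. (For `α ≠ 0` and `t > 0` this is the infimum of a nonempty set of
nonnegative reals.) -/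
def metricMahler (t : ℝ) (α : Alg) : ℝ :=
  sInf ((fun A => measureFun A t) '' productReps α)

/-- A finite set `X` of product representations of `α` is an infimum set for `α` if, for every
`t > 0`, the value `m_t(α)` is the minimum of `f_A(t)` over `A ∈ X`. -/
def IsInfimumSet (α : Alg) (X : Set (List Alg)) : Prop :=
  X.Finite ∧ X ⊆ productReps α ∧
    ∀ t : ℝ, 0 < t → IsLeast ((fun A => measureFun A t) '' X) (metricMahler t α)

/-- The set `ℱ(α)` of factorizations of `α`: the product representations
`(r₁/s₁, …, r_N/s_N)` of `α` with `rₙ, sₙ` positive integers, `rₙ/sₙ ≠ 1` for all `n`, and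
`gcd(rₘ, sₙ) = 1` for all `m, n`. -/
def factorizations (α : Alg) : Set (List Alg) :=
  {A | A ∈ productReps α ∧ ∃ e : List (ℕ × ℕ),
    A = e.map (fun x => (x.1 : Alg) / (x.2 : Alg)) ∧
    (∀ x ∈ e, 0 < x.1 ∧ 0 < x.2 ∧ (x.1 : Alg) / (x.2 : Alg) ≠ 1) ∧
    ∀ x ∈ e, ∀ y ∈ e, Nat.gcd x.1 y.2 = 1}

/-! ### Upper and lower best approximations -/

/-- The fraction `a / b` of a pair `(a, b) ≠ (0, 0)` of natural numbers, as an extended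
nonnegative real; so `a / 0 = ∞` for `a > 0`. -/
def ratio (x : ℕ × ℕ) : ℝ≥0∞ := (x.1 : ℝ≥0∞) / (x.2 : ℝ≥0∞)

/-- The upper set `𝒰(ξ)`. -/
def upperSet (ξ : ℝ) : Set (ℕ × ℕ) := {x | x ≠ (0, 0) ∧ (x.2 : ℝ) * ξ < (x.1 : ℝ)}

/-- The lower set `ℒ(ξ)`. -/
def lowerSet (ξ : ℝ) : Set (ℕ × ℕ) := {x | x ≠ (0, 0) ∧ (x.1 : ℝ) < (x.2 : ℝ) * ξ}

/-- `(a, b)` is an upper best approximation for `ξ`: `gcd(a, b) = 1`, `(a, b) ∈ 𝒰(ξ)`, and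
`a/b = min {m/n : (m, n) ∈ 𝒰(ξ), m ≤ a}`. -/
def IsUpperBest (ξ : ℝ) (x : ℕ × ℕ) : Prop :=
  Nat.gcd x.1 x.2 = 1 ∧ x ∈ upperSet ξ ∧
    IsLeast (ratio '' {y | y ∈ upperSet ξ ∧ y.1 ≤ x.1}) (ratio x)

/-- `(a, b)` is a lower best approximation for `ξ`: `gcd(a, b) = 1`, `(a, b) ∈ ℒ(ξ)`, and
`a/b = max {m/n : (m, n) ∈ ℒ(ξ), n ≤ b}`. -/
def IsLowerBest (ξ : ℝ) (x : ℕ × ℕ) : Prop :=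
  Nat.gcd x.1 x.2 = 1 ∧ x ∈ lowerSet ξ ∧
    IsGreatest (ratio '' {y | y ∈ lowerSet ξ ∧ y.2 ≤ x.2}) (ratio x)

/-- The set `ℬ(α)` (for given `p`, `q`): the factorizations `(p^a₁/q^b₁, …, p^a_N/q^b_N)` of `α`
in which every `(aₙ, bₙ)` is an upper or a lower best approximation for `log q / log p`. -/
def bestFactorizations (p q : ℕ) (α : Alg) : Set (List Alg) :=
  {A | A ∈ factorizations α ∧ ∃ e : List (ℕ × ℕ),
    A = e.map (fun x => (p : Alg) ^ x.1 / (q : Alg) ^ x.2) ∧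
    ∀ x ∈ e, IsUpperBest (Real.log q / Real.log p) x ∨ IsLowerBest (Real.log q / Real.log p) x}

end

end MetricMahler

/-! ### Heights of quotients of natural numbers -/

namespace MetricMahler

open NumberField Height

/-! The problem reduces to exponent vectors. For every algebraic `α`, positive integers `c, d` with
logarithm at most `m(α)` make `cα` and `d/α` integral. Multiplying over a representation of
`p^a/q^b` shows that the `d`'s together carry `p^a` and the `c`'s carry `q^b`. So `(a, b)` splits
into pairs, one per entry, with `max (aₙ log p) (bₙ log q)` at most the measure of that entry
(`exists_exponents_le_mahler`). Since `p^aₙ/q^bₙ` has measure at most that maximum, it suffices to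
minimize the sum of t-th powers of these weights over splittings of `(a, b)`.

For `t ≤ 1` subadditivity makes the one-term splitting optimal. For `t > 1` a minimizer exists by
finiteness, and a part that is not a best approximation can be improved (`exists_cost_lt_of_above`):
either it breaks into two parts on the same side of the line `a log p = b log q`, where weights add
and `x ↦ x^t` is strictly superadditive, or it absorbs, at no cost, a unit from a part on the other
side, making that one cheaper. The second move is blocked only if all parts lie on one side, and
then the optimality of `(a, b)` itself is violated. -/

theorem finprod_finitePlace_iSup_natCast_le_one {K : Type*} [Field K] [NumberField K] (u v : ℕ) :
    ∏ᶠ w : FinitePlace K, ⨆ i, w ((![(u : K), (v : K)] : Fin 2 → K) i) ≤ 1 := by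
  have h : ∀ w : FinitePlace K, ∀ n : ℕ, w (n : K) ≤ 1 := fun w n => by
    have hw : IsNonarchimedean (w ·) := FinitePlace.add_le w
    simpa using IsNonarchimedean.apply_intCast_le_one hw (n := (n : ℤ))
  refine (finprod_induction (fun x : ℝ => 0 ≤ x ∧ x ≤ 1) ⟨zero_le_one, le_rfl⟩
    (fun x y hx hy => ⟨mul_nonneg hx.1 hy.1, mul_le_one₀ hx.2 hy.1 hy.2⟩) fun w => ?_).2
  refine ⟨Real.iSup_nonneg fun i => apply_nonneg w _, ciSup_le fun i => ?_⟩
  fin_cases i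
  · exact h w u
  · exact h w v

/-- Finite places contribute at most 1, and the multiplicities of the infinite places add up to the
degree. Only an upper bound is needed, so coprimality plays no role. -/
theorem mulHeight₁_natCast_div_le {K : Type*} [Field K] [NumberField K] (u : ℕ) {v : ℕ}
    (hv : v ≠ 0) : mulHeight₁ ((u : K) / (v : K)) ≤ (max u v : ℝ) ^ Module.finrank ℚ K := by
  rw [mulHeight₁_div_eq_mulHeight, NumberField.mulHeight_eq (by simp [hv])]
  refine (mul_le_of_le_one_right ?_ (finprod_finitePlace_iSup_natCast_le_one u v)).trans ?_
  · exact Finset.prod_nonneg fun w _ =>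
      pow_nonneg (Real.iSup_nonneg fun i => apply_nonneg w _) _
  rw [← InfinitePlace.sum_mult_eq, ← Finset.prod_pow_eq_pow_sum]
  refine Finset.prod_le_prod (fun w _ =>
    pow_nonneg (Real.iSup_nonneg fun i => apply_nonneg w _) _) fun w _ => ?_
  refine pow_le_pow_left₀ (Real.iSup_nonneg fun i => apply_nonneg w _) (ciSup_le fun i => ?_) _
  fin_cases i <;> simp

/-! ### Mahler measure and denominators -/

instance : Algebra.IsAlgebraic ℚ Alg := AlgebraicClosure.isAlgebraic ℚ

instance (α : Alg) : NumberField ℚ⟮α⟯ where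
  to_finiteDimensional :=
    IntermediateField.adjoin.finiteDimensional (Algebra.IsIntegral.isIntegral α)

theorem mahler_eq_log_mulHeight₁ (α : Alg) :
    mahler α = Real.log (mulHeight₁ (IntermediateField.AdjoinSimple.gen ℚ α)) := by
  have hα : IsIntegral ℚ α := Algebra.IsIntegral.isIntegral α
  have hd : (Module.finrank ℚ ℚ⟮α⟯ : ℝ) ≠ 0 := by
    exact_mod_cast (Module.finrank_pos (R := ℚ) (M := ℚ⟮α⟯)).ne'
  rw [mahler, absLogHeight₁, absMulHeight₁, dif_pos hα, Real.log_rpow (mulHeight₁_pos _),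
    mul_inv_cancel_left₀ hd]

theorem mahler_nonneg (α : Alg) : 0 ≤ mahler α := by
  rw [mahler_eq_log_mulHeight₁]
  exact Real.log_nonneg (one_le_mulHeight₁ _)

theorem mahler_natCast_div_le (u : ℕ) {v : ℕ} (hv : v ≠ 0) :
    mahler ((u : Alg) / (v : Alg)) ≤ Real.log (max u v) := by
  set α : Alg := (u : Alg) / (v : Alg) with hα
  have hgen : IntermediateField.AdjoinSimple.gen ℚ α = (u : ℚ⟮α⟯) / (v : ℚ⟮α⟯) := by
    apply Subtype.ext
    simp [hα]
  have hd : Module.finrank ℚ ℚ⟮α⟯ = 1 := by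
    rw [IntermediateField.finrank_adjoin_simple_eq_one_iff, IntermediateField.mem_bot]
    exact ⟨(u : ℚ) / v, by simp [hα]⟩
  rw [mahler_eq_log_mulHeight₁]
  refine Real.log_le_log (mulHeight₁_pos _) ?_
  have := mulHeight₁_natCast_div_le (K := ℚ⟮α⟯) u hv
  rwa [hd, pow_one, ← hgen] at this

/-- The logarithmic Mahler measure bounds denominators. -/
theorem exists_isIntegral_natCast_mul (α : Alg) :
    ∃ c : ℕ, c ≠ 0 ∧ Real.log c ≤ mahler α ∧ IsIntegral ℤ ((c : Alg) * α) := by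
  obtain ⟨c, hc, hle, hint⟩ :=
    exists_nat_le_mulHeight₁ (IntermediateField.AdjoinSimple.gen ℚ α)
  refine ⟨c, hc, ?_, ?_⟩
  · rw [mahler_eq_log_mulHeight₁]
    exact Real.log_le_log (by positivity) hle
  · simpa using hint.map (ℚ⟮α⟯.val.restrictScalars ℤ)

/-- The height is invariant under inversion, so numerators are controlled in the same way as
denominators. -/
theorem exists_isIntegral_natCast_mul_inv (α : Alg) :
    ∃ c : ℕ, c ≠ 0 ∧ Real.log c ≤ mahler α ∧ IsIntegral ℤ ((c : Alg) * α⁻¹) := by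
  obtain ⟨c, hc, hle, hint⟩ :=
    exists_nat_le_mulHeight₁ (IntermediateField.AdjoinSimple.gen ℚ α)⁻¹
  rw [mulHeight₁_inv] at hle
  refine ⟨c, hc, ?_, ?_⟩
  · rw [mahler_eq_log_mulHeight₁]
    exact Real.log_le_log (by positivity) hle
  · simpa using hint.map (ℚ⟮α⟯.val.restrictScalars ℤ)

theorem dvd_of_isIntegral_natCast_div {m n : ℕ} (hn : n ≠ 0)
    (h : IsIntegral ℤ ((m : Alg) / (n : Alg))) : n ∣ m := by
  have h' : IsIntegral ℤ ((m : ℚ) / n) := by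
    rw [← isIntegral_algebraMap_iff (algebraMap ℚ Alg).injective]
    simpa using h
  obtain ⟨z, hz⟩ := IsIntegrallyClosed.isIntegral_iff.mp h'
  have hn' : (n : ℚ) ≠ 0 := by exact_mod_cast hn
  rw [eq_div_iff hn'] at hz
  have hz' : z * (n : ℤ) = m := by
    have : (z : ℚ) * n = m := by simpa using hz
    exact_mod_cast this
  exact Int.natCast_dvd_natCast.mp ⟨z, by rw [← hz', mul_comm]⟩

theorem isIntegral_natCast_prod_mul_prod {β F : Type*} [Field F] (A : List β) (c : β → ℕ)
    (f : β → F) (h : ∀ x ∈ A, IsIntegral ℤ ((c x : F) * f x)) :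
    IsIntegral ℤ (((A.map c).prod : ℕ) * (A.map f).prod : F) := by
  induction A with
  | nil => simpa using isIntegral_one
  | cons x A ih =>
    rw [List.map_cons, List.prod_cons, List.map_cons, List.prod_cons, Nat.cast_mul,
      mul_mul_mul_comm]
    exact (h x (by simp)).mul (ih fun y hy => h y (by simp [hy]))

theorem factorization_listProd {β : Type*} (A : List β) (c : β → ℕ) (hc : ∀ x, c x ≠ 0) (p : ℕ) :
    (A.map c).prod.factorization p = (A.map fun x => (c x).factorization p).sum := by
  induction A with
  | nil => simp
  | cons x A ih =>
    rw [List.map_cons, List.prod_cons, Nat.factorization_mul (hc x) (by simp [hc]),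
      List.map_cons, List.sum_cons, ← ih, Finsupp.add_apply]

theorem factorization_mul_log_le {p : ℕ} (c : ℕ) (hp : 1 < p) (hc : c ≠ 0) :
    (c.factorization p : ℝ) * Real.log p ≤ Real.log c := by
  rw [← Real.log_pow]
  refine Real.log_le_log (by positivity) ?_
  exact_mod_cast Nat.le_of_dvd (Nat.pos_of_ne_zero hc) (Nat.ordProj_dvd c p)

theorem exists_list_sum_eq {β : Type*} (A : List β) (u v : β → ℕ) :
    ∀ a b : ℕ, a ≤ (A.map u).sum → b ≤ (A.map v).sum →
    ∃ e : List (ℕ × ℕ), List.Forall₂ (fun x y => x.1 ≤ u y ∧ x.2 ≤ v y) e A ∧ e.sum = (a, b) := by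
  induction A with
  | nil =>
    intro a b ha hb
    simp only [List.map_nil, List.sum_nil, Nat.le_zero] at ha hb
    exact ⟨[], by simp [ha, hb, Prod.zero_eq_mk]⟩
  | cons y A ih =>
    intro a b ha hb
    simp only [List.map_cons, List.sum_cons] at ha hb
    -- Greedy choice: the head takes as much as its capacity allows.
    obtain ⟨e, he, hs⟩ := ih (a - min a (u y)) (b - min b (v y)) (by omega) (by omega)
    refine ⟨(min a (u y), min b (v y)) :: e,
      List.Forall₂.cons ⟨min_le_right _ _, min_le_right _ _⟩ he, ?_⟩
    rw [List.sum_cons, hs]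
    ext <;> simp

/-- A product representation of `p ^ a / q ^ b` dominates one by elements `p ^ aₙ / q ^ bₙ`. -/
theorem exists_exponents_le_mahler {p q : ℕ} (hp : p.Prime) (hq : q.Prime) (hpq : p ≠ q)
    {a b : ℕ} {A : List Alg} (hA : A ∈ productReps ((p : Alg) ^ a / (q : Alg) ^ b)) :
    ∃ e : List (ℕ × ℕ), List.Forall₂
      (fun x y => max ((x.1 : ℝ) * Real.log p) (x.2 * Real.log q) ≤ mahler y) e A ∧
      e.sum = (a, b) := by
  obtain ⟨-, -, hprod⟩ := hA
  choose c hc hcm hci using exists_isIntegral_natCast_mul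
  choose d hd hdm hdi using exists_isIntegral_natCast_mul_inv
  have hC : (A.map c).prod ≠ 0 := by simp [hc]
  have hD : (A.map d).prod ≠ 0 := by simp [hd]
  have h1 := isIntegral_natCast_prod_mul_prod A d (fun x => x⁻¹) fun x _ => hdi x
  have h2 := isIntegral_natCast_prod_mul_prod A c id fun x _ => hci x
  have hinv : (A.map fun x => x⁻¹).prod = (A.prod)⁻¹ := by
    rw [List.prod_inv]
  rw [hinv, hprod] at h1
  rw [List.map_id, hprod] at h2
  -- The product of the `d`'s times `q^b/p^a` is a rational algebraic integer, hence an integer.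
  have e1 : p ^ a ∣ (A.map d).prod * q ^ b := by
    refine dvd_of_isIntegral_natCast_div (pow_ne_zero _ hp.ne_zero) ?_
    rwa [Nat.cast_mul, Nat.cast_pow, Nat.cast_pow, mul_div_assoc, ← inv_div]
  have e2 : q ^ b ∣ (A.map c).prod * p ^ a := by
    refine dvd_of_isIntegral_natCast_div (pow_ne_zero _ hq.ne_zero) ?_
    rwa [Nat.cast_mul, Nat.cast_pow, Nat.cast_pow, mul_div_assoc]
  have hcop : Nat.Coprime (p ^ a) (q ^ b) :=
    Nat.Coprime.pow _ _ ((Nat.coprime_primes hp hq).mpr hpq)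
  replace e1 := (hp.pow_dvd_iff_le_factorization hD).mp (hcop.dvd_of_dvd_mul_right e1)
  replace e2 := (hq.pow_dvd_iff_le_factorization hC).mp (hcop.symm.dvd_of_dvd_mul_right e2)
  rw [factorization_listProd A d hd] at e1
  rw [factorization_listProd A c hc] at e2
  obtain ⟨e, he, hs⟩ := exists_list_sum_eq A _ _ a b e1 e2
  refine ⟨e, he.imp fun x y hxy => max_le ?_ ?_, hs⟩
  · refine le_trans ?_ ((factorization_mul_log_le _ hp.one_lt (hd y)).trans (hdm y))
    have := Real.log_nonneg (Nat.one_le_cast.mpr hp.one_le : (1 : ℝ) ≤ p)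
    gcongr
    exact hxy.1
  · refine le_trans ?_ ((factorization_mul_log_le _ hq.one_lt (hc y)).trans (hcm y))
    have := Real.log_nonneg (Nat.one_le_cast.mpr hq.one_le : (1 : ℝ) ≤ q)
    gcongr
    exact hxy.2

end MetricMahler

namespace MetricMahler

/-! ### Sums of pairs of natural numbers -/

/-- The lists of nonzero pairs of natural numbers with sum `s`. -/
def pairLists (s : ℕ × ℕ) : Set (List (ℕ × ℕ)) := {e | (∀ x ∈ e, x ≠ 0) ∧ e.sum = s}

theorem length_le_sum_fst_add_snd {e : List (ℕ × ℕ)} (he : ∀ x ∈ e, x ≠ 0) :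
    e.length ≤ e.sum.1 + e.sum.2 := by
  induction e with
  | nil => simp
  | cons x e ih =>
    have h1 := ih fun y hy => he y (by simp [hy])
    have h2 : x.1 + x.2 ≠ 0 := fun h => he x (by simp) (by ext <;> simp <;> omega)
    simp only [List.length_cons, List.sum_cons, Prod.fst_add, Prod.snd_add]
    omega

theorem finite_pairLists (s : ℕ × ℕ) : (pairLists s).Finite := by
  refine ((List.finite_length_le (Set.Iic s) (s.1 + s.2)).image (List.map Subtype.val)).subset ?_
  rintro e ⟨h0, hs⟩
  have hle : ∀ x ∈ e, x ∈ Set.Iic s := fun x hx =>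
    hs ▸ List.single_le_sum (fun y _ => zero_le) x hx
  exact ⟨e.attach.map fun x => ⟨x.1, hle _ x.2⟩, by
    simpa [hs] using length_le_sum_fst_add_snd h0, by
    rw [List.map_map]
    exact List.attach_map_subtype_val e⟩

/-- The weight of `(a, b)`; for `P = log p`, `Q = log q` it is the Mahler measure of
`p ^ a / q ^ b`. -/
noncomputable def weight (P Q : ℝ) (x : ℕ × ℕ) : ℝ := max (x.1 * P) (x.2 * Q)

/-- The quantity to minimize; the root `1 / t` is monotone and taken only at the end. -/
noncomputable def cost (P Q t : ℝ) (e : List (ℕ × ℕ)) : ℝ := (e.map fun x => weight P Q x ^ t).sum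

/-- The pairs `(a, b)` with `b * Q < a * P`. -/
def Above (P Q : ℝ) (x : ℕ × ℕ) : Prop := x.2 * Q < x.1 * P

/-- `(a, b)` is an upper best approximation for `Q / P`, in terms of integers only. -/
def BestAbove (P Q : ℝ) (x : ℕ × ℕ) : Prop :=
  Nat.gcd x.1 x.2 = 1 ∧ Above P Q x ∧
    ∀ y : ℕ × ℕ, Above P Q y → y.1 ≤ x.1 → x.1 * y.2 ≤ y.1 * x.2

/-! ### Best approximations by cross-multiplication -/

theorem ratio_le_ratio {x y : ℕ × ℕ} (hx : x ≠ 0) (hy : y ≠ 0) :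
    ratio x ≤ ratio y ↔ x.1 * y.2 ≤ y.1 * x.2 := by
  obtain ⟨a, b⟩ := x
  obtain ⟨c, d⟩ := y
  have hx' : b = 0 → a ≠ 0 := fun h h' => hx (by ext <;> simp [h, h'])
  have hy' : d = 0 → c ≠ 0 := fun h h' => hy (by ext <;> simp [h, h'])
  simp only [ratio]
  rcases eq_or_ne d 0 with rfl | hd
  · simp [ENNReal.div_zero, hy' rfl]
  have hd0 : (d : ℝ≥0∞) ≠ 0 := by exact_mod_cast hd
  rcases eq_or_ne b 0 with rfl | hb
  · simp [ENNReal.div_zero, hx' rfl, hd, ENNReal.div_eq_top, top_le_iff]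
  have hb0 : (b : ℝ≥0∞) ≠ 0 := by exact_mod_cast hb
  rw [ENNReal.div_le_iff hb0 (ENNReal.natCast_ne_top b), ENNReal.mul_comm_div,
    ← mul_div_assoc, ENNReal.le_div_iff_mul_le (Or.inl hd0) (Or.inl (ENNReal.natCast_ne_top d))]
  norm_cast

theorem mem_upperSet_iff {P Q : ℝ} (hP : 0 < P) {x : ℕ × ℕ} :
    x ∈ upperSet (Q / P) ↔ x ≠ 0 ∧ Above P Q x := by
  rw [upperSet, Set.mem_ofPred_eq, ← mul_div_assoc, div_lt_iff₀ hP]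
  rfl

theorem mem_lowerSet_iff {P Q : ℝ} (hP : 0 < P) {x : ℕ × ℕ} :
    x ∈ lowerSet (Q / P) ↔ x ≠ 0 ∧ Above Q P x.swap := by
  rw [lowerSet, Set.mem_ofPred_eq, ← mul_div_assoc, lt_div_iff₀ hP]
  rfl

theorem Above.ne_zero {P Q : ℝ} {x : ℕ × ℕ} (h : Above P Q x) : x ≠ 0 := by
  rintro rfl
  simp [Above] at h

theorem isUpperBest_iff {P Q : ℝ} (hP : 0 < P) {x : ℕ × ℕ} :
    IsUpperBest (Q / P) x ↔ BestAbove P Q x := by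
  simp only [IsUpperBest, BestAbove, mem_upperSet_iff hP]
  refine and_congr_right fun _ => ⟨fun ⟨h1, h2⟩ => ⟨h1.2, fun y hy hyx => ?_⟩,
    fun ⟨h1, h2⟩ => ⟨⟨h1.ne_zero, h1⟩, ⟨x, ⟨⟨h1.ne_zero, h1⟩, le_rfl⟩, rfl⟩, ?_⟩⟩
  · exact (ratio_le_ratio h1.1 hy.ne_zero).mp (h2.2 ⟨y, ⟨⟨hy.ne_zero, hy⟩, hyx⟩, rfl⟩)
  · rintro _ ⟨y, ⟨⟨hy0, hy⟩, hyx⟩, rfl⟩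
    exact (ratio_le_ratio h1.ne_zero hy0).mpr (h2 y hy hyx)

/-- Swapping coordinates together with `P` and `Q` exchanges the two kinds of approximation, so
later arguments treat only one side. -/
theorem isLowerBest_iff {P Q : ℝ} (hP : 0 < P) {x : ℕ × ℕ} :
    IsLowerBest (Q / P) x ↔ BestAbove Q P x.swap := by
  have hsw : ∀ {y : ℕ × ℕ}, Above Q P y.swap → y ≠ 0 := fun h h0 => h.ne_zero (by rw [h0]; rfl)
  simp only [IsLowerBest, BestAbove, mem_lowerSet_iff hP, Prod.fst_swap, Prod.snd_swap]
  rw [Nat.gcd_comm]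
  refine and_congr_right fun _ => ⟨fun ⟨h1, h2⟩ => ⟨h1.2, fun y hy hyx => ?_⟩,
    fun ⟨h1, h2⟩ => ⟨⟨hsw h1, h1⟩, ⟨x, ⟨⟨hsw h1, h1⟩, le_rfl⟩, rfl⟩, ?_⟩⟩
  · have hy' : Above Q P y.swap.swap := by rwa [Prod.swap_swap]
    have := (ratio_le_ratio (hsw hy') h1.1).mp (h2.2 ⟨y.swap, ⟨⟨hsw hy', hy'⟩, hyx⟩, rfl⟩)
    simpa [mul_comm] using this
  · rintro _ ⟨y, ⟨⟨hy0, hy⟩, hyx⟩, rfl⟩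
    refine (ratio_le_ratio hy0 (hsw h1)).mpr ?_
    have := h2 y.swap hy hyx
    simpa [mul_comm] using this

/-! ### Weights, costs and exchange moves -/

section

variable {P Q t : ℝ}

theorem Above.add {x y : ℕ × ℕ} (hx : Above P Q x) (hy : Above P Q y) : Above P Q (x + y) := by
  simp only [Above, Prod.fst_add, Prod.snd_add, Nat.cast_add, add_mul] at *
  linarith

theorem weight_nonneg (hP : 0 ≤ P) (x : ℕ × ℕ) : 0 ≤ weight P Q x :=
  le_max_of_le_left (by positivity)

theorem weight_swap (x : ℕ × ℕ) : weight Q P x.swap = weight P Q x := max_comm _ _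

theorem Above.weight_eq {x : ℕ × ℕ} (hx : Above P Q x) : weight P Q x = x.1 * P :=
  max_eq_left hx.le

theorem Above.weight_pos (hQ : 0 ≤ Q) {x : ℕ × ℕ} (hx : Above P Q x) : 0 < weight P Q x := by
  rw [hx.weight_eq]
  exact lt_of_le_of_lt (by positivity) hx

theorem Above.weight_add {x y : ℕ × ℕ} (hx : Above P Q x) (hy : Above P Q y) :
    weight P Q (x + y) = weight P Q x + weight P Q y := by
  rw [(hx.add hy).weight_eq, hx.weight_eq, hy.weight_eq]
  simp [add_mul]

theorem weight_add_le (x y : ℕ × ℕ) : weight P Q (x + y) ≤ weight P Q x + weight P Q y := by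
  simp only [weight, Prod.fst_add, Prod.snd_add, Nat.cast_add, add_mul]
  exact max_le (add_le_add (le_max_left _ _) (le_max_left _ _))
    (add_le_add (le_max_right _ _) (le_max_right _ _))

@[simp]
theorem cost_nil : cost P Q t [] = 0 := rfl

@[simp]
theorem cost_cons (x : ℕ × ℕ) (e : List (ℕ × ℕ)) :
    cost P Q t (x :: e) = weight P Q x ^ t + cost P Q t e := by
  simp [cost]

theorem cost_perm {e f : List (ℕ × ℕ)} (h : e.Perm f) : cost P Q t e = cost P Q t f :=
  (h.map _).sum_eq

theorem cost_swap (e : List (ℕ × ℕ)) : cost Q P t (e.map Prod.swap) = cost P Q t e := by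
  simp [cost, Function.comp_def, weight_swap]

theorem sum_map_swap (e : List (ℕ × ℕ)) : (e.map Prod.swap).sum = e.sum.swap := by
  induction e with
  | nil => rfl
  | cons x e ih => simp [ih]

theorem map_swap_mem_pairLists {s : ℕ × ℕ} {e : List (ℕ × ℕ)} (he : e ∈ pairLists s) :
    e.map Prod.swap ∈ pairLists s.swap := by
  refine ⟨?_, by rw [sum_map_swap, he.2]⟩
  intro x hx
  obtain ⟨y, hy, rfl⟩ := List.mem_map.mp hx
  exact fun h => he.1 y hy (by rw [← Prod.swap_swap y, h]; rfl)

/-- Zero pairs cost `0 ^ t = 0`, so they can be discarded. -/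
theorem exists_pairLists_cost_eq (ht : 0 < t) (e : List (ℕ × ℕ)) :
    ∃ f ∈ pairLists e.sum, cost P Q t f = cost P Q t e := by
  induction e with
  | nil => exact ⟨[], ⟨by simp, rfl⟩, rfl⟩
  | cons x e ih =>
    obtain ⟨f, ⟨hf0, hf⟩, hc⟩ := ih
    by_cases hx : x = 0
    · refine ⟨f, ⟨hf0, by simp [hf, hx]⟩, ?_⟩
      simp [hx, hc, weight, Real.zero_rpow ht.ne']
    · refine ⟨x :: f, ⟨?_, by simp [hf]⟩, by simp [hc]⟩
      simpa [hx] using hf0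

theorem weight_sum_rpow_le_cost (hP : 0 ≤ P) (ht : 0 < t) (ht1 : t ≤ 1) (e : List (ℕ × ℕ)) :
    weight P Q e.sum ^ t ≤ cost P Q t e := by
  induction e with
  | nil => simp [weight, Real.zero_rpow ht.ne']
  | cons x e ih =>
    rw [List.sum_cons, cost_cons]
    calc weight P Q (x + e.sum) ^ t ≤ (weight P Q x + weight P Q e.sum) ^ t :=
          Real.rpow_le_rpow (weight_nonneg hP _) (weight_add_le _ _) ht.le
      _ ≤ weight P Q x ^ t + weight P Q e.sum ^ t :=
          Real.rpow_add_le_add_rpow (weight_nonneg hP _) (weight_nonneg hP _) ht.le ht1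
      _ ≤ _ := by gcongr

theorem add_rpow_lt_rpow_add {x y : ℝ} (hx : 0 < x) (hy : 0 < y) (ht : 1 < t) :
    x ^ t + y ^ t < (x + y) ^ t := by
  have key : ∀ {u v : ℝ}, 0 < u → 0 < v → u ^ t < u * (u + v) ^ (t - 1) := fun {u v} hu hv => by
    calc u ^ t = u * u ^ (t - 1) := by rw [← Real.rpow_one_add' hu.le (by linarith)]; ring_nf
      _ < u * (u + v) ^ (t - 1) := by
        gcongr
        linarith
  have h1 := key hx hy
  have h2 := key hy hx
  rw [add_comm y x] at h2
  have h3 : (x + y) ^ t = (x + y) * (x + y) ^ (t - 1) := by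
    rw [← Real.rpow_one_add' (by positivity) (by linarith)]; ring_nf
  rw [h3, add_mul]
  exact add_lt_add h1 h2

theorem above_list_sum {e : List (ℕ × ℕ)} {x : ℕ × ℕ} (hx : Above P Q x)
    (he : ∀ y ∈ e, Above P Q y) : Above P Q (x + e.sum) := by
  induction e generalizing x with
  | nil => simpa using hx
  | cons y e ih =>
    rw [List.sum_cons, ← add_assoc]
    exact ih (hx.add (he y (by simp))) fun z hz => he z (by simp [hz])

/-- A pair above `Q / P` that is not best and admits no larger second coordinate is a sum of two
pairs above `Q / P`. -/
theorem Above.exists_add (hP : 0 < P) (hQ : 0 < Q) {x : ℕ × ℕ} (hx : Above P Q x)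
    (hx1 : ¬ Above P Q (x + (0, 1))) (hb : ¬ BestAbove P Q x) :
    ∃ y z, Above P Q y ∧ Above P Q z ∧ x = y + z := by
  obtain ⟨a, b⟩ := x
  simp only [Above, BestAbove, not_and_or, not_forall, not_lt, not_le, Prod.fst_add,
    Prod.snd_add, Nat.cast_add, Nat.cast_one, add_zero, exists_prop] at *
  have ha : 0 < a := by
    by_contra h
    have h0 : a = 0 := by omega
    subst h0
    have : 0 ≤ (b : ℝ) * Q := by positivity
    simp at hx
    linarith
  rcases hb with hg | hx' | ⟨⟨m, n⟩, hmn, hma, hlt⟩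
  · obtain ⟨a', b', hcop, ha', hb'⟩ := Nat.exists_coprime a b
    set g := a.gcd b with hgdef
    have hgpos : 0 < g := Nat.gcd_pos_of_pos_left _ ha
    -- The gcd is at least 2: one primitive copy splits off and `k + 1` copies remain.
    obtain ⟨k, hk⟩ : ∃ k, g = k + 2 := ⟨g - 2, by omega⟩
    have hab : (b' : ℝ) * Q < a' * P := by
      rw [ha', hb', Nat.cast_mul, Nat.cast_mul] at hx
      have : (0 : ℝ) < g := by exact_mod_cast hgpos
      nlinarith
    refine ⟨(a', b'), ((k + 1) * a', (k + 1) * b'), hab, ?_, ?_⟩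
    · push_cast
      have : (0 : ℝ) < k + 1 := by positivity
      nlinarith
    · rw [hk] at ha' hb'
      ext
      · simp only [Prod.fst_add]; rw [ha']; ring
      · simp only [Prod.snd_add]; rw [hb']; ring
  · linarith
  · simp only at hmn hma hlt
    have hmr : (m : ℝ) ≤ a := by exact_mod_cast hma
    have hltr : (m : ℝ) * b < a * n := by exact_mod_cast hlt
    -- From `nQ < mP ≤ aP ≤ (b + 1)Q`, the last inequality being `hx1`.
    have hnb : n ≤ b := by
      have h1 : (n : ℝ) * Q < (b + 1) * Q := by nlinarith
      have h2 : (n : ℝ) < b + 1 := lt_of_mul_lt_mul_right h1 hQ.le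
      have : n < b + 1 := by exact_mod_cast h2
      omega
    have hnpos : 0 < n := Nat.pos_of_ne_zero fun h => by simp [h] at hlt
    -- The better competitor splits off. The remainder is above because `mb < an` gives it a larger
    -- ratio than `m/n`.
    refine ⟨(m, n), (a - m, b - n), hmn, ?_, ?_⟩
    · simp only
      rw [Nat.cast_sub hma, Nat.cast_sub hnb]
      have hn : (0 : ℝ) < n := by exact_mod_cast hnpos
      have hbn : (n : ℝ) ≤ b := by exact_mod_cast hnb
      have h1 : (m : ℝ) * (b - n) * P < (a - m) * n * P := by
        apply mul_lt_mul_of_pos_right _ hP; nlinarith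
      have h2 : (n : ℝ) * Q * (b - n) ≤ m * P * (b - n) :=
        mul_le_mul_of_nonneg_right hmn.le (by linarith)
      refine lt_of_mul_lt_mul_left (a := (n : ℝ)) ?_ hn.le
      linarith
    · ext <;> simp <;> omega

/-- The hypothesis `hs` is an implication so that it holds vacuously for `s` below the line; thus
both kinds of `s` are covered. -/
theorem exists_cost_lt_of_above (hP : 0 < P) (hQ : 0 < Q)
    (hne : ∀ x : ℕ × ℕ, x ≠ 0 → (x.1 : ℝ) * P ≠ x.2 * Q) (ht : 1 < t) {s : ℕ × ℕ}
    (hs : Above P Q s → ¬ Above P Q (s + (0, 1))) {e : List (ℕ × ℕ)} (he : e ∈ pairLists s)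
    {x : ℕ × ℕ} (hxe : x ∈ e) (hx : Above P Q x) (hb : ¬ BestAbove P Q x) :
    ∃ f ∈ pairLists s, cost P Q t f < cost P Q t e := by
  have ht0 : 0 < t := by linarith
  -- An exchange may create a zero pair, which is dropped free of charge.
  suffices h : ∃ f : List (ℕ × ℕ), f.sum = s ∧ cost P Q t f < cost P Q t e by
    obtain ⟨f, hf, hlt⟩ := h
    obtain ⟨g, hg, hc⟩ := exists_pairLists_cost_eq (P := P) (Q := Q) ht0 f
    exact ⟨g, hf ▸ hg, hc ▸ hlt⟩
  have hperm := List.perm_cons_erase hxe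
  have hsum := hperm.sum_eq
  rw [he.2, List.sum_cons] at hsum
  rw [cost_perm hperm, cost_cons]
  by_cases hx1 : Above P Q (x + (0, 1))
  · by_cases hall : ∀ y ∈ e.erase x, Above P Q y
    · have h1 := above_list_sum hx hall
      have h2 := above_list_sum hx1 hall
      rw [add_right_comm] at h2
      rw [← hsum] at h1 h2
      exact absurd h2 (hs h1)
    · push Not at hall
      obtain ⟨⟨c, d⟩, hye, hy⟩ := hall
      have hperm' := List.perm_cons_erase hye
      have hy0 := he.1 _ (List.mem_of_mem_erase hye)
      have hlt : (c : ℝ) * P < d * Q := lt_of_le_of_ne (not_lt.mp hy) (hne _ hy0)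
      obtain ⟨k, rfl⟩ : ∃ k, d = k + 1 := by
        refine ⟨d - 1, ?_⟩
        have : d ≠ 0 := by
          rintro rfl
          have : 0 ≤ (c : ℝ) * P := by positivity
          simp at hlt
          linarith
        omega
      -- A unit moves from a part below to `x`. Since `x` stays above, its weight still depends only
      -- on its first coordinate, while the other part gets strictly lighter.
      refine ⟨(x + (0, 1)) :: (c, k) :: (e.erase x).erase (c, k + 1), ?_, ?_⟩
      · rw [hsum, hperm'.sum_eq, List.sum_cons, List.sum_cons, List.sum_cons,
          show ((c, k + 1) : ℕ × ℕ) = (0, 1) + (c, k) by ext <;> simp [add_comm]]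
        simp only [add_assoc]
      · rw [cost_perm hperm', cost_cons, cost_cons, cost_cons, hx.weight_eq, hx1.weight_eq]
        have hw : weight P Q (c, k) < weight P Q (c, k + 1) := by
          have h1 : weight P Q (c, k + 1) = (k + 1 : ℕ) * Q := max_eq_right hlt.le
          rw [h1]
          refine max_lt hlt ?_
          push_cast
          nlinarith
        have := Real.rpow_lt_rpow (weight_nonneg hP.le _) hw ht0
        simpa using this
  · obtain ⟨y, z, hy, hz, rfl⟩ := hx.exists_add hP hQ hx1 hb
    refine ⟨y :: z :: e.erase (y + z), ?_, ?_⟩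
    · rw [hsum, List.sum_cons, List.sum_cons, add_assoc]
    · rw [cost_cons, cost_cons, ← add_assoc, hy.weight_add hz]
      have := add_rpow_lt_rpow_add (hy.weight_pos hQ.le) (hz.weight_pos hQ.le) ht
      linarith

/-- Otherwise `s + (0, 1)` would be a competitor with the same first coordinate and a smaller ratio.
-/
theorem BestAbove.not_above_add (hQ : 0 < Q) {s : ℕ × ℕ} (h : BestAbove P Q s) :
    ¬ Above P Q (s + (0, 1)) := fun h1 => by
  have h2 := h.2.2 _ h1 le_rfl
  have h3 := h.2.1
  have : s.1 = 0 := by simp at h2; nlinarith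
  simp only [Above, this, Nat.cast_zero, zero_mul] at h3
  have : 0 ≤ (s.2 : ℝ) * Q := by positivity
  linarith

theorem Above.not_swap {x : ℕ × ℕ} (h : Above P Q x) : ¬ Above Q P x.swap := not_lt.mpr h.le

/-- Among all ways of writing a best approximation as a sum of pairs, one of minimal cost consists
of best approximations. -/
theorem exists_best_pairLists (hP : 0 < P) (hQ : 0 < Q)
    (hne : ∀ x : ℕ × ℕ, x ≠ 0 → (x.1 : ℝ) * P ≠ x.2 * Q) (ht : 0 < t) {s : ℕ × ℕ}
    (hs : BestAbove P Q s ∨ BestAbove Q P s.swap) :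
    ∃ e ∈ pairLists s, (∀ x ∈ e, BestAbove P Q x ∨ BestAbove Q P x.swap) ∧
      ∀ f : List (ℕ × ℕ), f.sum = s → cost P Q t e ≤ cost P Q t f := by
  have hs0 : s ≠ 0 := by
    rintro rfl
    rcases hs with h | h
    · exact h.2.1.ne_zero rfl
    · exact h.2.1.ne_zero rfl
  have hmem : [s] ∈ pairLists s := ⟨by simpa using hs0, by simp⟩
  rcases le_or_gt t 1 with ht1 | ht1
  · refine ⟨[s], hmem, by simpa using hs, ?_⟩
    rintro f rfl
    simpa using weight_sum_rpow_le_cost hP.le ht ht1 f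
  obtain ⟨e, he, hmin⟩ := Set.exists_min_image _ (cost P Q t) (finite_pairLists s) ⟨_, hmem⟩
  refine ⟨e, he, fun x hx => ?_, fun f hf => ?_⟩
  · by_contra hb
    push Not at hb
    -- The part lies strictly on one side of the line; the lower side is handled by swapping.
    rcases lt_or_gt_of_ne (hne x (he.1 x hx)) with h | h
    · have hne' : ∀ x : ℕ × ℕ, x ≠ 0 → (x.1 : ℝ) * Q ≠ x.2 * P := fun y hy h =>
        hne y.swap (fun h0 => hy (by rw [← y.swap_swap, h0]; rfl)) h.symm
      have hs' : Above Q P s.swap → ¬ Above Q P (s.swap + (0, 1)) := fun h1 =>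
        (hs.resolve_left fun h2 => h2.2.1.not_swap h1).not_above_add hP
      obtain ⟨f, hf, hlt⟩ := exists_cost_lt_of_above hQ hP hne' ht1 hs'
        (map_swap_mem_pairLists he) (List.mem_map_of_mem (f := Prod.swap) hx) h hb.2
      have := hmin _ (map_swap_mem_pairLists hf)
      rw [cost_swap] at this hlt
      linarith
    · have hs' : Above P Q s → ¬ Above P Q (s + (0, 1)) := fun h1 =>
        (hs.resolve_right fun h2 => h1.not_swap h2.2.1).not_above_add hQ
      obtain ⟨f, hf, hlt⟩ := exists_cost_lt_of_above hP hQ hne ht1 hs' he hx h hb.1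
      exact absurd (hmin f hf) (not_le.mpr hlt)
  · obtain ⟨g, hg, hc⟩ := exists_pairLists_cost_eq (P := P) (Q := Q) ht f
    exact hc ▸ hmin g (hf ▸ hg)

end

end MetricMahler

namespace MetricMahler

/-! ### Return to algebraic numbers -/

section

variable {p q : ℕ}

theorem mul_log_ne_mul_log (hp : p.Prime) (hq : q.Prime) (hpq : p ≠ q) (x : ℕ × ℕ) (hx : x ≠ 0) :
    (x.1 : ℝ) * Real.log p ≠ x.2 * Real.log q := fun h => by
  have hp0 : (0 : ℝ) < p := by exact_mod_cast hp.pos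
  have hq0 : (0 : ℝ) < q := by exact_mod_cast hq.pos
  rw [← Real.log_pow, ← Real.log_pow] at h
  have h1 : p ^ x.1 = q ^ x.2 := by
    exact_mod_cast Real.log_injOn_pos (Set.mem_Ioi.mpr (pow_pos hp0 _))
      (Set.mem_Ioi.mpr (pow_pos hq0 _)) h
  have hcop := Nat.Coprime.pow x.1 x.2 ((Nat.coprime_primes hp hq).mpr hpq)
  rw [← h1, Nat.coprime_self, Nat.pow_eq_one] at hcop
  have h2 : x.1 = 0 := hcop.resolve_left hp.ne_one
  rw [h2, pow_zero, eq_comm, Nat.pow_eq_one] at h1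
  exact hx (Prod.ext h2 (h1.resolve_left hq.ne_one))

theorem pow_div_pow_injective (hp : p.Prime) (hq : q.Prime) (hpq : p ≠ q) {a b c d : ℕ}
    (h : (p : Alg) ^ a / (q : Alg) ^ b = (p : Alg) ^ c / (q : Alg) ^ d) : a = c ∧ b = d := by
  have hq0 : (q : Alg) ≠ 0 := by exact_mod_cast hq.ne_zero
  rw [div_eq_div_iff (pow_ne_zero _ hq0) (pow_ne_zero _ hq0)] at h
  have h1 : p ^ a * q ^ d = p ^ c * q ^ b := by exact_mod_cast h
  have h2 := congrArg Nat.factorization h1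
  rw [Nat.factorization_mul (pow_ne_zero _ hp.ne_zero) (pow_ne_zero _ hq.ne_zero),
    Nat.factorization_mul (pow_ne_zero _ hp.ne_zero) (pow_ne_zero _ hq.ne_zero),
    hp.factorization_pow, hq.factorization_pow, hp.factorization_pow, hq.factorization_pow] at h2
  have h3 := DFunLike.congr_fun h2 p
  have h4 := DFunLike.congr_fun h2 q
  simp [hpq, hpq.symm] at h3 h4
  exact ⟨h3, h4.symm⟩

theorem prod_map_pow_div_pow (e : List (ℕ × ℕ)) :
    (e.map fun x => (p : Alg) ^ x.1 / (q : Alg) ^ x.2).prod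
      = (p : Alg) ^ e.sum.1 / (q : Alg) ^ e.sum.2 := by
  induction e with
  | nil => simp
  | cons x e ih =>
    rw [List.map_cons, List.prod_cons, ih, List.sum_cons, Prod.fst_add, Prod.snd_add, pow_add,
      pow_add, div_mul_div_comm]

/-- Equality holds, but the comparison of representations needs only this direction. -/
theorem mahler_pow_div_pow_le (hp : p.Prime) (hq : q.Prime) (x : ℕ × ℕ) :
    mahler ((p : Alg) ^ x.1 / (q : Alg) ^ x.2) ≤ weight (Real.log p) (Real.log q) x := by
  have h := mahler_natCast_div_le (p ^ x.1) (v := q ^ x.2) (pow_ne_zero _ hq.ne_zero)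
  rw [Nat.cast_pow, Nat.cast_pow, Nat.cast_pow, Nat.cast_pow] at h
  refine h.trans (le_of_eq ?_)
  rw [weight, ← Real.log_pow, ← Real.log_pow]
  have hp0 : (0 : ℝ) < p := by exact_mod_cast hp.pos
  have hq0 : (0 : ℝ) < q := by exact_mod_cast hq.pos
  exact Real.strictMonoOn_log.monotoneOn.map_max (Set.mem_Ioi.mpr (pow_pos hp0 _))
      (Set.mem_Ioi.mpr (pow_pos hq0 _))

theorem map_mem_factorizations (hp : p.Prime) (hq : q.Prime) (hpq : p ≠ q) {s : ℕ × ℕ}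
    (hs : s ≠ 0) {e : List (ℕ × ℕ)} (he : e ∈ pairLists s) :
    e.map (fun x => (p : Alg) ^ x.1 / (q : Alg) ^ x.2) ∈
      factorizations ((p : Alg) ^ s.1 / (q : Alg) ^ s.2) := by
  have hp0 : (p : Alg) ≠ 0 := by exact_mod_cast hp.ne_zero
  have hq0 : (q : Alg) ≠ 0 := by exact_mod_cast hq.ne_zero
  refine ⟨⟨?_, ?_, by rw [prod_map_pow_div_pow, he.2]⟩,
    e.map fun x => (p ^ x.1, q ^ x.2), by simp, ?_, ?_⟩
  · rw [Ne, List.map_eq_nil_iff]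
    rintro rfl
    exact hs (by simpa using he.2.symm)
  · intro x hx
    obtain ⟨y, -, rfl⟩ := List.mem_map.mp hx
    exact div_ne_zero (pow_ne_zero _ hp0) (pow_ne_zero _ hq0)
  · intro x hx
    obtain ⟨y, hy, rfl⟩ := List.mem_map.mp hx
    refine ⟨pow_pos hp.pos _, pow_pos hq.pos _, fun h => he.1 y hy ?_⟩
    have h1 : (p : Alg) ^ y.1 / (q : Alg) ^ y.2 = (p : Alg) ^ 0 / (q : Alg) ^ 0 := by
      simpa using h
    exact Prod.ext_iff.mpr (pow_div_pow_injective hp hq hpq h1)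
  · intro x hx y hy
    obtain ⟨x, -, rfl⟩ := List.mem_map.mp hx
    obtain ⟨y, -, rfl⟩ := List.mem_map.mp hy
    exact Nat.Coprime.pow _ _ ((Nat.coprime_primes hp hq).mpr hpq)

theorem best_iff (hp : p.Prime) (x : ℕ × ℕ) :
    IsUpperBest (Real.log q / Real.log p) x ∨ IsLowerBest (Real.log q / Real.log p) x ↔
      BestAbove (Real.log p) (Real.log q) x ∨ BestAbove (Real.log q) (Real.log p) x.swap := by
  have hP : 0 < Real.log p := Real.log_pos (by exact_mod_cast hp.one_lt)
  rw [isUpperBest_iff hP, isLowerBest_iff hP]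

/-- By unique factorization the exponent pairs must sum to `(a, b)`, and there are finitely many
lists of nonzero pairs with that sum. -/
theorem finite_bestFactorizations (hp : p.Prime) (hq : q.Prime) (hpq : p ≠ q) (a b : ℕ) :
    (bestFactorizations p q ((p : Alg) ^ a / (q : Alg) ^ b)).Finite := by
  refine ((finite_pairLists (a, b)).image
    (List.map fun x => (p : Alg) ^ x.1 / (q : Alg) ^ x.2)).subset ?_
  rintro A ⟨hA, e, rfl, he⟩
  refine ⟨e, ⟨fun x hx h0 => ?_, ?_⟩, rfl⟩
  · rcases (best_iff hp x).mp (he x hx) with h | h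
    · exact h.2.1.ne_zero h0
    · exact h.2.1.ne_zero (by rw [h0]; rfl)
  · have h := hA.1.2.2
    rw [prod_map_pow_div_pow] at h
    exact Prod.ext_iff.mpr (pow_div_pow_injective hp hq hpq h)

theorem measureFun_map_le (hp : p.Prime) (hq : q.Prime) {t : ℝ} (ht : 0 < t)
    (e : List (ℕ × ℕ)) :
    measureFun (e.map fun x => (p : Alg) ^ x.1 / (q : Alg) ^ x.2) t ≤
      cost (Real.log p) (Real.log q) t e ^ (1 / t) := by
  rw [measureFun, cost, List.map_map]
  refine Real.rpow_le_rpow (List.sum_nonneg ?_) (List.sum_le_sum fun x _ => ?_) (by positivity)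
  · intro y hy
    obtain ⟨x, -, rfl⟩ := List.mem_map.mp hy
    exact Real.rpow_nonneg (mahler_nonneg _) _
  · exact Real.rpow_le_rpow (mahler_nonneg _) (mahler_pow_div_pow_le hp hq x) ht.le

theorem cost_nonneg {P Q t : ℝ} (hP : 0 ≤ P) (e : List (ℕ × ℕ)) : 0 ≤ cost P Q t e := by
  refine List.sum_nonneg fun y hy => ?_
  obtain ⟨x, -, rfl⟩ := List.mem_map.mp hy
  exact Real.rpow_nonneg (weight_nonneg hP _) _

theorem cost_le_sum_mahler_rpow {P Q t : ℝ} (hP : 0 ≤ P) (ht : 0 < t) {e : List (ℕ × ℕ)}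
    {A : List Alg} (h : List.Forall₂ (fun x y => weight P Q x ≤ mahler y) e A) :
    cost P Q t e ≤ (A.map fun y => mahler y ^ t).sum := by
  induction h with
  | nil => simp
  | cons h _ ih =>
    rw [cost_cons, List.map_cons, List.sum_cons]
    exact add_le_add (Real.rpow_le_rpow (weight_nonneg hP _) h ht.le) ih

theorem isInfimumSet_bestFactorizations (hp : p.Prime) (hq : q.Prime) (hpq : p ≠ q) (a b : ℕ)
    (hab : IsUpperBest (Real.log q / Real.log p) (a, b) ∨
      IsLowerBest (Real.log q / Real.log p) (a, b)) :
    IsInfimumSet ((p : Alg) ^ a / (q : Alg) ^ b)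
      (bestFactorizations p q ((p : Alg) ^ a / (q : Alg) ^ b)) := by
  have hP : 0 < Real.log p := Real.log_pos (by exact_mod_cast hp.one_lt)
  have hQ : 0 < Real.log q := Real.log_pos (by exact_mod_cast hq.one_lt)
  have hs : ((a, b) : ℕ × ℕ) ≠ 0 := by
    rcases hab with h | h
    · exact h.2.1.1
    · exact h.2.1.1
  refine ⟨finite_bestFactorizations hp hq hpq a b, fun A hA => hA.1.1, fun t ht => ?_⟩
  obtain ⟨e, he, hbest, hmin⟩ := exists_best_pairLists hP hQ
    (mul_log_ne_mul_log hp hq hpq) ht ((best_iff hp _).mp hab)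
  have hB : e.map (fun x => (p : Alg) ^ x.1 / (q : Alg) ^ x.2) ∈
      bestFactorizations p q ((p : Alg) ^ a / (q : Alg) ^ b) :=
    ⟨map_mem_factorizations hp hq hpq hs he, e, rfl, fun x hx => (best_iff hp x).mpr (hbest x hx)⟩
  -- The costs of the minimizer `e` and of the exponent list `f` extracted from `A` interpolate
  -- between the two measures. Hence the infimum over all representations is attained inside the
  -- smaller set.
  have hle : ∀ A ∈ productReps ((p : Alg) ^ a / (q : Alg) ^ b),
      measureFun (e.map fun x => (p : Alg) ^ x.1 / (q : Alg) ^ x.2) t ≤ measureFun A t := by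
    intro A hA
    obtain ⟨f, hf, hfs⟩ := exists_exponents_le_mahler hp hq hpq hA
    refine (measureFun_map_le hp hq ht e).trans ?_
    exact Real.rpow_le_rpow (cost_nonneg hP.le e)
      ((hmin f hfs).trans (cost_le_sum_mahler_rpow hP.le ht hf)) (by positivity)
  have hleast : IsLeast ((fun A => measureFun A t) '' productReps ((p : Alg) ^ a / (q : Alg) ^ b))
      (measureFun (e.map fun x => (p : Alg) ^ x.1 / (q : Alg) ^ x.2) t) := by
    refine ⟨⟨_, hB.1.1, rfl⟩, ?_⟩
    rintro _ ⟨A, hA, rfl⟩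
    exact hle A hA
  rw [metricMahler, hleast.csInf_eq]
  refine ⟨⟨_, hB, rfl⟩, ?_⟩
  rintro _ ⟨A, hA, rfl⟩
  exact hle A hA.1.1

end

end MetricMahler

theorem corollary3p3 (p q : ℕ) (hp : p.Prime) (hq : q.Prime) (hpq : p ≠ q) (a b : ℕ)
    (hab : MetricMahler.IsUpperBest (Real.log q / Real.log p) (a, b) ∨
      MetricMahler.IsLowerBest (Real.log q / Real.log p) (a, b)) :
    MetricMahler.IsInfimumSet ((p : MetricMahler.Alg) ^ a / (q : MetricMahler.Alg) ^ b)
      (MetricMahler.bestFactorizations p q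
        ((p : MetricMahler.Alg) ^ a / (q : MetricMahler.Alg) ^ b)) :=
  MetricMahler.isInfimumSet_bestFactorizations hp hq hpq a b hab
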